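/- Let $L$ be a fixed separable infinite-dimensional complex Hilbert space, let $\mathcal B=\mathcal B(L)$, and let $\mathcal K=\mathcal K(L)$ be the algebra of compact operators on $L$. For a complex linear space $E$ let $\mathcal KE:=\mathcal K\otimes E$ (algebraic tensor product), a $\mathcal B$-bimodule via $b\cdot(a\otimes x)=(ba)\otimes x$, $(a\otimes x)\cdot b=(ab)\otimes x$. A quantum norm on $E$ is a norm on $\mathcal KE$ such that $\|b\cdot u\|,\|u\cdot b\|\le\|b\|\,\|u\|$ for all $b\in\mathcal B$, $u\in\mathcal KE$, and $\|u+v\|=\max\{\|u\|,\|v\|\}$ whenever there are orthogonal projections $P,Q\in\mathcal B$ with $PQ=0$, $P\cdot u=u=u\cdot P$ and $Q\cdot v=v=v\cdot Q$. An injective linear map $I:E\to\mathcal B(H,K)$, with $H,K$ Hilbert spaces, gives the concrete quantum norm on $E$ in which the norm of $\sum_k a_k\otimes x_k\in\mathcal KE$ is the operator norm of $\sum_k a_k\otimes I(x_k)$, acting between the Hilbert tensor products of $L$ with $H$ and of $L$ with $K$; for a subspace $E\subseteq\mathcal B(H,K)$ and the inclusion $I$ it is called the standard quantization of $E$. For a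 Hilbert space $H$ (inner product $\langle\cdot,\cdot\rangle$ linear in the first variable, conjugate space $\overline H$), the column space $H_c$ and the row space $H_r$ are $H$ with the concrete quantum norms given by $H\to\mathcal B(\mathbb C,H)$, $x\mapsto(c\mapsto cx)$, and by $H\to\mathcal B(\overline H,\mathbb C)$, $x\mapsto(\overline y\mapsto\langle x,y\rangle)$; $\overline H_r$ is the row space of the Hilbert space $\overline H$. For quantum spaces $E,F$ let $\odot:\mathcal KE\times\mathcal KF\to\mathcal K(E\otimes F)$ be the bilinear map with $(a\otimes x)\odot(b\otimes y)=(ab)\otimes(x\otimes y)$. The (non-completed) Haagerup tensor product $E\otimes_hF$ is the algebraic tensor product $E\otimes F$ with $$\|U\|_h=\inf\Big\{\sum_{k=1}^n\|u_k\|\,\|v_k\|\;:\;U=\sum_{k=1}^n u_k\odot v_k,\ u_k\in\mathcal KE,\ v_k\in\mathcal KF\Big\},\qquad U\in\mathcal K(E\otimes F).$$ Proposition 27. Let $H$ be a Hilbert space, and let $\mathcal F(H)\subseteq\mathcal B(H)$ be the space of bounded operators on $H$ of finite rank with its standard quantization. Then $H_c\otimes_h\overline H_r$ and $\mathcal F(H)$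 are quantum spaces (that is, their norms on the amplifications are quantum norms), and they are completely isometrically isomorphic: there is a linear isomorphism $\varphi:H\otimes\overline H\to\mathcal F(H)$, with $\varphi(x\otimes\overline y)=\langle\cdot,y\rangle\,x$ for all $x,y\in H$, whose amplification $\mathbf 1_{\mathcal K}\otimes\varphi:\mathcal K(H\otimes\overline H)\to\mathcal K\mathcal F(H)$ is an isometric isomorphism. -/

import Mathlib

open scoped TensorProduct InnerProductSpace

noncomputable section

namespace QFA

/-! ### The complex-conjugate Hilbert space -/

/-- The complex-conjugate `H̄` of `H`: the same additive group and norm, with scalar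
multiplication `c • x̄ = (conj c • x)‾` and inner product `⟪x̄, ȳ⟫ = ⟪y, x⟫`. -/
def ConjSpace (H : Type*) : Type _ := H

namespace ConjSpace

variable {H : Type*} [NormedAddCommGroup H] [InnerProductSpace ℂ H]

instance : NormedAddCommGroup (ConjSpace H) := inferInstanceAs (NormedAddCommGroup H)

/-- The identity map `x ↦ x̄`, as an additive bijection. -/
def conj (H : Type*) [NormedAddCommGroup H] : H ≃+ ConjSpace H := AddEquiv.refl H

instance : Module ℂ (ConjSpace H) := Module.compHom H (starRingEnd ℂ)

theorem smul_conj (c : ℂ) (x : H) : c • conj H x = conj H (starRingEnd ℂ c • x) := rfl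

theorem norm_conj {H : Type*} [NormedAddCommGroup H] (x : H) : ‖conj H x‖ = ‖x‖ := rfl

instance : NormedSpace ℂ (ConjSpace H) where
  norm_smul_le c x := by
    obtain ⟨x, rfl⟩ := (conj H).surjective x
    rw [smul_conj, norm_conj, norm_conj, norm_smul, RCLike.norm_conj]

instance : InnerProductSpace ℂ (ConjSpace H) where
  inner x y := inner ℂ ((conj H).symm y) ((conj H).symm x)
  norm_sq_eq_re_inner x := by
    obtain ⟨x, rfl⟩ := (conj H).surjective x
    rw [norm_conj, AddEquiv.symm_apply_apply]
    exact norm_sq_eq_re_inner x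
  conj_inner_symm x y := inner_conj_symm _ _
  add_left x y z := by rw [map_add, inner_add_right]
  smul_left x y c := by
    obtain ⟨x, rfl⟩ := (conj H).surjective x
    rw [smul_conj, AddEquiv.symm_apply_apply, AddEquiv.symm_apply_apply, inner_smul_right]

theorem inner_conj_conj (x y : H) : inner ℂ (conj H x) (conj H y) = inner ℂ y x := rfl

instance [CompleteSpace H] : CompleteSpace (ConjSpace H) := inferInstanceAs (CompleteSpace H)

end ConjSpace

/-! ### Hilbert tensor products -/

section Hilbert

variable {H₁ H₂ K₁ K₂ : Type*}
  [NormedAddCommGroup H₁] [InnerProductSpace ℂ H₁] [NormedAddCommGroup H₂] [InnerProductSpace ℂ H₂]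
  [NormedAddCommGroup K₁] [InnerProductSpace ℂ K₁] [NormedAddCommGroup K₂] [InnerProductSpace ℂ K₂]

/-- The Hilbert tensor product: the completion of the algebraic tensor product in the norm
given by `⟪a ⊗ b, c ⊗ d⟫ = ⟪a, c⟫ * ⟪b, d⟫`. -/
abbrev HilbertTensor (H K : Type*) [NormedAddCommGroup H] [InnerProductSpace ℂ H]
    [NormedAddCommGroup K] [InnerProductSpace ℂ K] : Type _ :=
  UniformSpace.Completion (H ⊗[ℂ] K)

/-- The Hilbert tensor product of two bounded operators, the bounded operator
with `ξ ⊗ η ↦ a ξ ⊗ b η`. -/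
def hilbertMap (a : H₁ →L[ℂ] K₁) (b : H₂ →L[ℂ] K₂) :
    HilbertTensor H₁ H₂ →L[ℂ] HilbertTensor K₁ K₂ :=
  (TensorProduct.mapL a b).completion

theorem hilbertMap_coe (a : H₁ →L[ℂ] K₁) (b : H₂ →L[ℂ] K₂) (t : H₁ ⊗[ℂ] H₂) :
    hilbertMap a b (t : HilbertTensor H₁ H₂) =
      ((TensorProduct.mapL a b t : K₁ ⊗[ℂ] K₂) : HilbertTensor K₁ K₂) :=
  ContinuousLinearMap.completion_apply_coe _ _

theorem clm_ext {f g : HilbertTensor H₁ H₂ →L[ℂ] HilbertTensor K₁ K₂}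
    (h : ∀ t : H₁ ⊗[ℂ] H₂, f (t : HilbertTensor H₁ H₂) = g (t : HilbertTensor H₁ H₂)) : f = g :=
  ContinuousLinearMap.coeFn_injective
    (UniformSpace.Completion.ext f.continuous g.continuous h)

/-- `hilbertMap` as a bilinear map. -/
def hilbertMapₗ (H₁ H₂ K₁ K₂ : Type*)
    [NormedAddCommGroup H₁] [InnerProductSpace ℂ H₁] [NormedAddCommGroup H₂]
    [InnerProductSpace ℂ H₂] [NormedAddCommGroup K₁] [InnerProductSpace ℂ K₁]
    [NormedAddCommGroup K₂] [InnerProductSpace ℂ K₂] :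
    (H₁ →L[ℂ] K₁) →ₗ[ℂ] (H₂ →L[ℂ] K₂) →ₗ[ℂ]
      (HilbertTensor H₁ H₂ →L[ℂ] HilbertTensor K₁ K₂) :=
  LinearMap.mk₂ ℂ hilbertMap
    (fun a a' b => clm_ext fun t => by
      simp [hilbertMap_coe, TensorProduct.mapL_add_left, UniformSpace.Completion.coe_add])
    (fun c a b => clm_ext fun t => by
      simp [hilbertMap_coe, TensorProduct.mapL_smul_left, UniformSpace.Completion.coe_smul])
    (fun a b b' => clm_ext fun t => by
      simp [hilbertMap_coe, TensorProduct.mapL_add_right, UniformSpace.Completion.coe_add])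
    (fun c a b => clm_ext fun t => by
      simp [hilbertMap_coe, TensorProduct.mapL_smul_right, UniformSpace.Completion.coe_smul])

end Hilbert

/-! ### Amplifications and quantum norms -/

section Quantum

variable (L : Type*) [NormedAddCommGroup L] [InnerProductSpace ℂ L]

/-- The algebra `𝒦` of compact operators on `L`. -/
abbrev Cpt : Submodule ℂ (L →L[ℂ] L) := compactOperator (RingHom.id ℂ) L L

/-- The amplification `𝒦E = 𝒦 ⊗ E` (algebraic tensor product) of a linear space `E`. -/
abbrev Amp (E : Type*) [AddCommGroup E] [Module ℂ E] : Type _ := Cpt L ⊗[ℂ] E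

variable {L}

/-- Left multiplication of compact operators by a bounded operator. -/
def cptLeft (b : L →L[ℂ] L) : Cpt L →ₗ[ℂ] Cpt L where
  toFun a := ⟨b * a.1, IsCompactOperator.clm_comp a.2 b⟩
  map_add' _ _ := Subtype.ext (mul_add _ _ _)
  map_smul' _ _ := Subtype.ext (mul_smul_comm _ _ _)

/-- Right multiplication of compact operators by a bounded operator. -/
def cptRight (b : L →L[ℂ] L) : Cpt L →ₗ[ℂ] Cpt L where
  toFun a := ⟨a.1 * b, IsCompactOperator.comp_clm a.2 b⟩
  map_add' _ _ := Subtype.ext (add_mul _ _ _)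
  map_smul' _ _ := Subtype.ext (smul_mul_assoc _ _ _)

variable (L) in
/-- Multiplication of compact operators, as a bilinear map. -/
def cptMul : Cpt L →ₗ[ℂ] Cpt L →ₗ[ℂ] Cpt L :=
  LinearMap.mk₂ ℂ (fun a b => ⟨a.1 * b.1, IsCompactOperator.comp_clm a.2 b.1⟩)
    (fun _ _ _ => Subtype.ext (add_mul _ _ _))
    (fun _ _ _ => Subtype.ext (smul_mul_assoc _ _ _))
    (fun _ _ _ => Subtype.ext (mul_add _ _ _))
    (fun _ _ _ => Subtype.ext (mul_smul_comm _ _ _))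

variable {E F : Type*} [AddCommGroup E] [Module ℂ E] [AddCommGroup F] [Module ℂ F]

/-- The left outer multiplication on `𝒦E`: `b · (a ⊗ x) = (b a) ⊗ x`. -/
def leftMul (b : L →L[ℂ] L) : Amp L E →ₗ[ℂ] Amp L E := (cptLeft b).rTensor E

/-- The right outer multiplication on `𝒦E`: `(a ⊗ x) · b = (a b) ⊗ x`. -/
def rightMul (u : Amp L E) (b : L →L[ℂ] L) : Amp L E := (cptRight b).rTensor E u

variable (L) in
/-- The amplification `φ_∞ = 1 ⊗ φ : 𝒦E → 𝒦F` of a linear map `φ : E → F`. -/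
def amplify (φ : E →ₗ[ℂ] F) : Amp L E →ₗ[ℂ] Amp L F := φ.lTensor (Cpt L)

/-- `N` is a quantum norm on `E`: a norm on `𝒦E` satisfying both axioms of Ruan. -/
structure IsQuantumNorm [CompleteSpace L] (N : Amp L E → ℝ) : Prop where
  add_le : ∀ u v, N (u + v) ≤ N u + N v
  smul : ∀ (c : ℂ) u, N (c • u) = ‖c‖ * N u
  eq_zero : ∀ u, N u = 0 → u = 0
  left_le : ∀ (b : L →L[ℂ] L) u, N (leftMul b u) ≤ ‖b‖ * N u
  right_le : ∀ (b : L →L[ℂ] L) u, N (rightMul u b) ≤ ‖b‖ * N u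
  add_eq_max : ∀ (P Q : L →L[ℂ] L) (u v : Amp L E),
    IsStarProjection P → IsStarProjection Q → P * Q = 0 →
    leftMul P u = u → rightMul u P = u → leftMul Q v = v → rightMul v Q = v →
    N (u + v) = max (N u) (N v)

/-- The linear isomorphism `φ` between the quantum spaces `(E, N)` and `(F, M)` is completely
isometric: its amplification preserves the norm. -/
def IsCompletelyIsometric (N : Amp L E → ℝ) (M : Amp L F → ℝ) (φ : E ≃ₗ[ℂ] F) : Prop :=
  ∀ u : Amp L E, M (amplify L φ.toLinearMap u) = N u

/-! ### Concrete quantum norms -/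

section Concrete

variable {H K : Type*} [NormedAddCommGroup H] [InnerProductSpace ℂ H]
  [NormedAddCommGroup K] [InnerProductSpace ℂ K]

variable (L) in
/-- For a linear map `I : E → B(H, K)`, the linear map `𝒦E → B(L ⊗ H, L ⊗ K)` with
`a ⊗ x ↦ a ⊗ I x`. -/
def concreteMap (I : E →ₗ[ℂ] (H →L[ℂ] K)) :
    Amp L E →ₗ[ℂ] (HilbertTensor L H →L[ℂ] HilbertTensor L K) :=
  TensorProduct.lift ((hilbertMapₗ L H L K).compl₁₂ (Cpt L).subtype I)

variable (L) in
/-- The concrete quantum norm associated to an injective linear map `I : E → B(H, K)`. -/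
def concreteNorm (I : E →ₗ[ℂ] (H →L[ℂ] K)) (u : Amp L E) : ℝ := ‖concreteMap L I u‖

variable (L) in
/-- The standard quantum norm of an operator space `E ⊆ B(H, K)`. -/
def standardNorm (E : Submodule ℂ (H →L[ℂ] K)) : Amp L E → ℝ := concreteNorm L E.subtype

variable (H) in
/-- The embedding `I_c : H → B(ℂ, H)` taking `x` to the operator `1 ↦ x`. -/
def colEmb : H →ₗ[ℂ] (ℂ →L[ℂ] H) := (ContinuousLinearMap.toSpanSingletonLE ℂ ℂ H).toLinearMap

open ConjSpace in
variable (H) in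
/-- The embedding `I_r : H → B(H̄, ℂ)` taking `x` to the functional `ȳ ↦ ⟨x, y⟩`, where
`⟨x, y⟩ = inner ℂ y x` is the inner product written linear in its first variable. -/
def rowEmb : H →ₗ[ℂ] (ConjSpace H →L[ℂ] ℂ) where
  toFun x := innerSL ℂ (conj H x)
  map_add' x y := by rw [map_add, map_add]
  map_smul' c x := by
    have h : conj H (c • x) = starRingEnd ℂ c • conj H x := by rw [smul_conj, Complex.conj_conj]
    rw [h, map_smulₛₗ, Complex.conj_conj, RingHom.id_apply]

open ConjSpace in
theorem rowEmb_apply (x y : H) : rowEmb H x (conj H y) = inner ℂ y x := rfl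

theorem colEmb_apply (x : H) (c : ℂ) : colEmb H x c = c • x := rfl

variable (L H) in
/-- The quantum norm of the column Hilbertian `H_c`. -/
def colNorm : Amp L H → ℝ := concreteNorm L (colEmb H)

variable (L H) in
/-- The quantum norm of the row Hilbertian `H_r`. -/
def rowNorm : Amp L H → ℝ := concreteNorm L (rowEmb H)

variable (H) in
/-- The operator space `ℱ(H) ⊆ B(H)` of bounded operators with finite-dimensional range. -/
def finiteRank : Submodule ℂ (H →L[ℂ] H) where
  carrier := {T | FiniteDimensional ℂ (LinearMap.range T.toLinearMap)}
  zero_mem' := by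
    change FiniteDimensional ℂ (LinearMap.range (0 : H →ₗ[ℂ] H))
    rw [LinearMap.range_zero]
    infer_instance
  add_mem' {S T} hS hT := by
    have hS' : FiniteDimensional ℂ (LinearMap.range S.toLinearMap) := hS
    have hT' : FiniteDimensional ℂ (LinearMap.range T.toLinearMap) := hT
    exact Submodule.finiteDimensional_of_le
      (LinearMap.range_add_le S.toLinearMap T.toLinearMap)
  smul_mem' c T hT := by
    have hT' : FiniteDimensional ℂ (LinearMap.range T.toLinearMap) := hT
    refine Submodule.finiteDimensional_of_le (S₂ := LinearMap.range T.toLinearMap) ?_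
    rintro _ ⟨x, rfl⟩
    exact ⟨c • x, map_smul _ _ _⟩

end Concrete

/-! ### The Haagerup tensor product -/

/-- The Effros symbol `u ⊙ v`: the bilinear map `𝒦E × 𝒦F → 𝒦(E ⊗ F)` with
`(a ⊗ x) ⊙ (b ⊗ y) = (a b) ⊗ (x ⊗ y)`. -/
def effros (u : Amp L E) (v : Amp L F) : Amp L (E ⊗[ℂ] F) :=
  TensorProduct.map₂ (cptMul L) (TensorProduct.mk ℂ E F) u v

theorem effros_tmul (a b : Cpt L) (x : E) (y : F) :
    effros (a ⊗ₜ[ℂ] x) (b ⊗ₜ[ℂ] y) = cptMul L a b ⊗ₜ[ℂ] (x ⊗ₜ[ℂ] y) := rfl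

/-- The norm of the Haagerup tensor product `E ⊗_h F` of the quantum spaces `(E, N)` and
`(F, M)`: the infimum of `∑ N (u k) * M (v k)` over all representations
`U = ∑ u k ⊙ v k`. The underlying linear space of `E ⊗_h F` is the algebraic tensor product. -/
def haagerupNorm (N : Amp L E → ℝ) (M : Amp L F → ℝ) (U : Amp L (E ⊗[ℂ] F)) : ℝ :=
  sInf {r : ℝ | ∃ (n : ℕ) (u : Fin n → Amp L E) (v : Fin n → Amp L F),
    U = ∑ k, effros (u k) (v k) ∧ r = ∑ k, N (u k) * M (v k)}

end Quantum

end QFA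

end

noncomputable section

namespace QFA

/-! ### Hilbert tensor products of operators -/

section HilbertMap

variable {H₁ H₂ K₁ K₂ J₁ J₂ : Type*}
  [NormedAddCommGroup H₁] [InnerProductSpace ℂ H₁] [NormedAddCommGroup H₂] [InnerProductSpace ℂ H₂]
  [NormedAddCommGroup K₁] [InnerProductSpace ℂ K₁] [NormedAddCommGroup K₂] [InnerProductSpace ℂ K₂]
  [NormedAddCommGroup J₁] [InnerProductSpace ℂ J₁] [NormedAddCommGroup J₂] [InnerProductSpace ℂ J₂]

/-! The Haagerup norm on `H ⊗ H̄` is shown to equal the concrete norm given by `x ⊗ ȳ ↦ ⟨·, y⟩ x`.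
Concrete norms are quantum norms (`isQuantumNorm_concreteNorm`), and this map is a bijection onto
`ℱ(H)`, so everything else is formal.

One inequality holds because `⊙` becomes composition: up to identifying `H` with its double
conjugate, the operator of `u ⊙ v` is the column operator `L ⊗ ℂ → L ⊗ H` of `u` after the row
operator `L ⊗ H → L ⊗ ℂ` of `v` (`concreteMap_effros`).

Conversely, let `T` be the operator of `U`, first assumed of finite rank. Since `L` is
infinite-dimensional, it contains an isometric copy of the range of `T`, so `T = B C` through `L`,
with `B`, `C` compact and `‖B‖ ‖C‖ ≤ ‖T‖` (`exists_compact_factorization`). Slicing `B` and `C`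
along an orthonormal basis of a finite-dimensional subspace that carries all `H`-legs of `U` gives
`u` and `v` with `U = u ⊙ v` and the right norms (`hasHaagerupDecomposition_of_mem_finiteRank`).

For general `U`, cut the `L`-leg by a finite-rank projection `p`. Then `p · U` has a finite-rank
operator, while `(1 - p) · U` has decompositions of arbitrarily small size: its compact coefficients
are small, and a compact operator is a combination of four squares of compact operators
(`hasHaagerupDecomposition_tmul`). -/

@[simp]
theorem hilbertMap_tmul (a : H₁ →L[ℂ] K₁) (b : H₂ →L[ℂ] K₂) (ξ : H₁) (η : H₂) :
    hilbertMap a b ((ξ ⊗ₜ[ℂ] η : H₁ ⊗[ℂ] H₂) : HilbertTensor H₁ H₂) =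
      ((a ξ ⊗ₜ[ℂ] b η : K₁ ⊗[ℂ] K₂) : HilbertTensor K₁ K₂) := by
  rw [hilbertMap_coe, TensorProduct.mapL_tmul]

theorem hilbertTensor_induction {p : HilbertTensor H₁ H₂ → Prop}
    (hc : IsClosed {x | p x}) (hz : p 0) (ha : ∀ x y, p x → p y → p (x + y))
    (ht : ∀ (ξ : H₁) (η : H₂), p ((ξ ⊗ₜ[ℂ] η : H₁ ⊗[ℂ] H₂) : HilbertTensor H₁ H₂))
    (x : HilbertTensor H₁ H₂) : p x := by
  refine UniformSpace.Completion.induction_on x hc fun t => ?_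
  induction t using TensorProduct.induction_on with
  | zero => exact hz
  | tmul ξ η => exact ht ξ η
  | add s t hs ht' => rw [UniformSpace.Completion.coe_add]; exact ha _ _ hs ht'

theorem clm_ext_tmul {X : Type*} [NormedAddCommGroup X] [NormedSpace ℂ X]
    {f g : HilbertTensor H₁ H₂ →L[ℂ] X}
    (h : ∀ (ξ : H₁) (η : H₂), f ((ξ ⊗ₜ[ℂ] η : H₁ ⊗[ℂ] H₂) : HilbertTensor H₁ H₂) =
      g ((ξ ⊗ₜ[ℂ] η : H₁ ⊗[ℂ] H₂) : HilbertTensor H₁ H₂)) : f = g := by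
  ext x
  refine hilbertTensor_induction (p := fun x => f x = g x) (isClosed_eq f.continuous g.continuous)
    (by simp) (fun x y hx hy => ?_) h x
  rw [map_add, map_add, hx, hy]

theorem hilbertMap_comp (a : K₁ →L[ℂ] J₁) (b : K₂ →L[ℂ] J₂) (a' : H₁ →L[ℂ] K₁)
    (b' : H₂ →L[ℂ] K₂) :
    hilbertMap a b ∘L hilbertMap a' b' = hilbertMap (a ∘L a') (b ∘L b') :=
  clm_ext_tmul fun ξ η => by simp

theorem norm_hilbertMap_le (a : H₁ →L[ℂ] K₁) (b : H₂ →L[ℂ] K₂) :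
    ‖hilbertMap a b‖ ≤ ‖a‖ * ‖b‖ := by
  refine ContinuousLinearMap.opNorm_le_bound _ (by positivity) fun x => ?_
  refine UniformSpace.Completion.induction_on (p := fun x => ‖hilbertMap a b x‖ ≤ ‖a‖ * ‖b‖ * ‖x‖)
    x ?_ fun t => ?_
  · exact isClosed_le (by fun_prop) (by fun_prop)
  · rw [hilbertMap_coe, UniformSpace.Completion.norm_coe, UniformSpace.Completion.norm_coe]
    exact ContinuousLinearMap.le_of_opNorm_le _ (TensorProduct.norm_mapL_le a b) t

/-- The adjoints are given as formal pairs, so that no factor has to be complete. -/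
theorem inner_hilbertMap_left {a : H₁ →L[ℂ] K₁} {a' : K₁ →L[ℂ] H₁} {b : H₂ →L[ℂ] K₂}
    {b' : K₂ →L[ℂ] H₂} (ha : ∀ x y, inner ℂ (a x) y = inner ℂ x (a' y))
    (hb : ∀ x y, inner ℂ (b x) y = inner ℂ x (b' y))
    (x : HilbertTensor H₁ H₂) (y : HilbertTensor K₁ K₂) :
    inner ℂ (hilbertMap a b x) y = inner ℂ x (hilbertMap a' b' y) := by
  refine hilbertTensor_induction
    (p := fun x => inner ℂ (hilbertMap a b x) y = inner ℂ x (hilbertMap a' b' y))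
    (isClosed_eq (by fun_prop) (by fun_prop)) (by simp)
    (fun x x' hx hx' => by rw [map_add, inner_add_left, inner_add_left, hx, hx']) (fun ξ η => ?_) x
  refine hilbertTensor_induction (p := fun y => inner ℂ (hilbertMap a b
      ((ξ ⊗ₜ[ℂ] η : H₁ ⊗[ℂ] H₂) : HilbertTensor H₁ H₂)) y =
      inner ℂ ((ξ ⊗ₜ[ℂ] η : H₁ ⊗[ℂ] H₂) : HilbertTensor H₁ H₂) (hilbertMap a' b' y))
    (isClosed_eq (by fun_prop) (by fun_prop)) (by simp)
    (fun y y' hy hy' => by rw [map_add, inner_add_right, inner_add_right, hy, hy'])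
    (fun ξ' η' => ?_) y
  simp [UniformSpace.Completion.inner_coe, ha, hb]

end HilbertMap

/-! ### Concrete norms satisfy Ruan's axioms -/

section Concrete

variable {L : Type*} [NormedAddCommGroup L] [InnerProductSpace ℂ L]
  {E F H K : Type*} [AddCommGroup E] [Module ℂ E] [AddCommGroup F] [Module ℂ F]
  [NormedAddCommGroup H] [InnerProductSpace ℂ H] [NormedAddCommGroup K] [InnerProductSpace ℂ K]

@[simp]
theorem concreteMap_tmul (I : E →ₗ[ℂ] (H →L[ℂ] K)) (a : Cpt L) (x : E) :
    concreteMap L I (a ⊗ₜ x) = hilbertMap a.1 (I x) := rfl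

theorem concreteMap_amplify (I : F →ₗ[ℂ] (H →L[ℂ] K)) (φ : E →ₗ[ℂ] F) (u : Amp L E) :
    concreteMap L I (amplify L φ u) = concreteMap L (I ∘ₗ φ) u := by
  induction u using TensorProduct.induction_on with
  | zero => simp
  | tmul a x => rfl
  | add u v hu hv => rw [map_add, map_add, map_add, hu, hv]

theorem concreteMap_leftMul (I : E →ₗ[ℂ] (H →L[ℂ] K)) (b : L →L[ℂ] L) (u : Amp L E) :
    concreteMap L I (leftMul b u) = hilbertMap b (.id ℂ K) ∘L concreteMap L I u := by
  induction u using TensorProduct.induction_on with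
  | zero => simp
  | tmul a x =>
    rw [concreteMap_tmul, hilbertMap_comp, ContinuousLinearMap.id_comp]
    rfl
  | add u v hu hv => rw [map_add, map_add, map_add, hu, hv, ContinuousLinearMap.comp_add]

theorem rightMul_add (u v : Amp L E) (b : L →L[ℂ] L) :
    rightMul (u + v) b = rightMul u b + rightMul v b := map_add _ _ _

theorem concreteMap_rightMul (I : E →ₗ[ℂ] (H →L[ℂ] K)) (b : L →L[ℂ] L) (u : Amp L E) :
    concreteMap L I (rightMul u b) = concreteMap L I u ∘L hilbertMap b (.id ℂ H) := by
  induction u using TensorProduct.induction_on with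
  | zero => simp [rightMul]
  | tmul a x =>
    rw [concreteMap_tmul, hilbertMap_comp, ContinuousLinearMap.comp_id]
    rfl
  | add u v hu hv => rw [rightMul_add, map_add, map_add, hu, hv, ContinuousLinearMap.add_comp]

theorem norm_hilbertMap_id_le (b : L →L[ℂ] L) : ‖hilbertMap b (.id ℂ K)‖ ≤ ‖b‖ :=
  (norm_hilbertMap_le _ _).trans
    (mul_le_of_le_one_right (norm_nonneg _) ContinuousLinearMap.norm_id_le)

/-- Matrix coefficients see `u` through its slices by the functionals `a ↦ ⟪ξ', a ξ⟫` on `𝒦`. These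
separate compact operators, which is how injectivity of `I` passes to the amplification. -/
theorem inner_concreteMap_tmul (I : E →ₗ[ℂ] (H →L[ℂ] K)) (u : Amp L E) (ξ ξ' : L) (η : H)
    (η' : K) :
    inner ℂ ((ξ' ⊗ₜ[ℂ] η' : L ⊗[ℂ] K) : HilbertTensor L K)
      (concreteMap L I u ((ξ ⊗ₜ[ℂ] η : L ⊗[ℂ] H) : HilbertTensor L H)) =
    inner ℂ η' (I (TensorProduct.lid ℂ E (((innerSL ℂ ξ').toLinearMap ∘ₗ
      (ContinuousLinearMap.apply ℂ L ξ).toLinearMap ∘ₗ (Cpt L).subtype).rTensor E u)) η) := by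
  induction u using TensorProduct.induction_on with
  | zero => simp
  | tmul a x => simp [UniformSpace.Completion.inner_coe]
  | add u v hu hv => simp only [map_add, add_apply, inner_add_right, hu, hv]

/-- In a basis of `E`, a tensor is a finite family of coordinates in `M`, and slicing by `f` applies
`f` to each coordinate. -/
theorem tensor_ext_of_separating {M : Type*} [AddCommGroup M] [Module ℂ M]
    {S : Set (M →ₗ[ℂ] ℂ)} (hS : ∀ m m', (∀ f ∈ S, f m = f m') → m = m') {u v : M ⊗[ℂ] E}
    (h : ∀ f ∈ S, TensorProduct.lid ℂ E (f.rTensor E u) =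
      TensorProduct.lid ℂ E (f.rTensor E v)) : u = v := by
  classical
  let B := Module.Free.chooseBasis ℂ E
  have hcoord (f : M →ₗ[ℂ] ℂ) (u : M ⊗[ℂ] E) (i) :
      B.repr (TensorProduct.lid ℂ E (f.rTensor E u)) i =
        f (TensorProduct.equivFinsuppOfBasisRight B u i) := by
    induction u using TensorProduct.induction_on with
    | zero => simp
    | tmul a x => simp [mul_comm]
    | add u v hu hv => simp only [map_add, Finsupp.add_apply, hu, hv]
  refine (TensorProduct.equivFinsuppOfBasisRight B).injective (Finsupp.ext fun i => ?_)
  refine hS _ _ fun f hf => ?_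
  rw [← hcoord, ← hcoord, h f hf]

theorem concreteMap_injective {I : E →ₗ[ℂ] (H →L[ℂ] K)} (hI : Function.Injective I) :
    Function.Injective (concreteMap L I) := by
  intro u v huv
  refine tensor_ext_of_separating (S := Set.range fun p : L × L =>
    (innerSL ℂ p.1).toLinearMap ∘ₗ (ContinuousLinearMap.apply ℂ L p.2).toLinearMap ∘ₗ
      (Cpt L).subtype) (fun a b hab => ?_) ?_
  · refine Subtype.ext (ContinuousLinearMap.ext fun ξ => ext_inner_left ℂ fun ξ' => ?_)
    have := hab _ ⟨(ξ', ξ), rfl⟩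
    simpa using this
  · rintro _ ⟨⟨ξ', ξ⟩, rfl⟩
    refine hI ?_
    ext η
    refine ext_inner_left ℂ fun η' => ?_
    rw [← inner_concreteMap_tmul, huv, inner_concreteMap_tmul]

/-- `S` and `T` have orthogonal ranges and see only the parts `P x` and `Q x` of a vector, so
Pythagoras bounds the sum. Composing `S + T` with `P` or `Q` recovers `S` or `T`. -/
theorem opNorm_add_eq_max {X Y : Type*} [NormedAddCommGroup X] [InnerProductSpace ℂ X]
    [NormedAddCommGroup Y] [InnerProductSpace ℂ Y] {P Q : X →L[ℂ] X} {P' Q' : Y →L[ℂ] Y}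
    {S T : X →L[ℂ] Y} (hPQ : ∀ x, ‖P x‖ ^ 2 + ‖Q x‖ ^ 2 ≤ ‖x‖ ^ 2)
    (hPQ' : ∀ x y, inner ℂ (P' x) (Q' y) = 0)
    (hSP : S ∘L P = S) (hPS : P' ∘L S = S) (hTQ : T ∘L Q = T) (hQT : Q' ∘L T = T)
    (hPT : T ∘L P = 0) (hQS : S ∘L Q = 0) (hP1 : ‖P‖ ≤ 1) (hQ1 : ‖Q‖ ≤ 1) :
    ‖S + T‖ = max ‖S‖ ‖T‖ := by
  apply le_antisymm
  · refine ContinuousLinearMap.opNorm_le_bound _ (by positivity) fun x => ?_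
    have hS : S x = S (P x) := by rw [← ContinuousLinearMap.comp_apply, hSP]
    have hT : T x = T (Q x) := by rw [← ContinuousLinearMap.comp_apply, hTQ]
    have h0 : inner ℂ (S x) (T x) = 0 := by
      rw [← hPS, ← hQT]; exact hPQ' _ _
    have h1 : ‖S x + T x‖ ^ 2 = ‖S x‖ ^ 2 + ‖T x‖ ^ 2 := by
      have := norm_add_sq_eq_norm_sq_add_norm_sq_of_inner_eq_zero (S x) (T x) h0
      simpa [sq] using this
    set m := max ‖S‖ ‖T‖
    have h2 : ‖S x‖ ≤ m * ‖P x‖ := by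
      rw [hS]; exact S.le_of_opNorm_le (le_max_left _ _) _
    have h3 : ‖T x‖ ≤ m * ‖Q x‖ := by
      rw [hT]; exact T.le_of_opNorm_le (le_max_right _ _) _
    rw [add_apply]
    refine (sq_le_sq₀ (norm_nonneg _) (by positivity)).1 ?_
    calc ‖S x + T x‖ ^ 2 = ‖S x‖ ^ 2 + ‖T x‖ ^ 2 := h1
      _ ≤ (m * ‖P x‖) ^ 2 + (m * ‖Q x‖) ^ 2 := by gcongr
      _ = m ^ 2 * (‖P x‖ ^ 2 + ‖Q x‖ ^ 2) := by ring
      _ ≤ m ^ 2 * ‖x‖ ^ 2 := by gcongr; exact hPQ x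
      _ = (m * ‖x‖) ^ 2 := by ring
  · refine max_le ?_ ?_
    · have : S = (S + T) ∘L P := by rw [ContinuousLinearMap.add_comp, hSP, hPT, add_zero]
      calc ‖S‖ = ‖(S + T) ∘L P‖ := by rw [← this]
        _ ≤ ‖S + T‖ * ‖P‖ := ContinuousLinearMap.opNorm_comp_le _ _
        _ ≤ ‖S + T‖ := mul_le_of_le_one_right (norm_nonneg _) hP1
    · have : T = (S + T) ∘L Q := by rw [ContinuousLinearMap.add_comp, hTQ, hQS, zero_add]
      calc ‖T‖ = ‖(S + T) ∘L Q‖ := by rw [← this]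
        _ ≤ ‖S + T‖ * ‖Q‖ := ContinuousLinearMap.opNorm_comp_le _ _
        _ ≤ ‖S + T‖ := mul_le_of_le_one_right (norm_nonneg _) hQ1

theorem inner_apply_left_of_isStarProjection [CompleteSpace L] {P : L →L[ℂ] L}
    (hP : IsStarProjection P) (x y : L) : inner ℂ (P x) y = inner ℂ x (P y) := by
  have h := hP.isSelfAdjoint.star_eq
  rw [ContinuousLinearMap.star_eq_adjoint] at h
  conv_rhs => rw [← h, ContinuousLinearMap.adjoint_inner_right]

theorem hilbertMap_id_comp_eq_zero {P Q : L →L[ℂ] L} (h : P * Q = 0) :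
    hilbertMap P (.id ℂ K) ∘L hilbertMap Q (.id ℂ K) = 0 := by
  rw [hilbertMap_comp, ← ContinuousLinearMap.mul_def, h]
  exact clm_ext_tmul fun ξ η => by simp

theorem inner_hilbertMap_id_left [CompleteSpace L] {P : L →L[ℂ] L} (hP : IsStarProjection P)
    (x y : HilbertTensor L K) : inner ℂ (hilbertMap P (.id ℂ K) x) y =
      inner ℂ x (hilbertMap P (.id ℂ K) y) :=
  inner_hilbertMap_left (inner_apply_left_of_isStarProjection hP) (fun _ _ => rfl) x y

theorem inner_hilbertMap_id_of_mul_eq_zero [CompleteSpace L] {P Q : L →L[ℂ] L}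
    (hP : IsStarProjection P) (h : P * Q = 0) (x y : HilbertTensor L K) :
    inner ℂ (hilbertMap P (.id ℂ K) x) (hilbertMap Q (.id ℂ K) y) = 0 := by
  rw [inner_hilbertMap_id_left hP, ← ContinuousLinearMap.comp_apply, hilbertMap_id_comp_eq_zero h]
  simp

theorem norm_smul_clm {X Y : Type*} [NormedAddCommGroup X] [NormedSpace ℂ X]
    [NormedAddCommGroup Y] [NormedSpace ℂ Y] (c : ℂ) (f : X →L[ℂ] Y) : ‖c • f‖ = ‖c‖ * ‖f‖ :=
  norm_smul c f

theorem isQuantumNorm_concreteNorm [CompleteSpace L] {I : E →ₗ[ℂ] (H →L[ℂ] K)}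
    (hI : Function.Injective I) : IsQuantumNorm (concreteNorm L I) where
  add_le u v := by
    rw [concreteNorm, map_add]
    exact norm_add_le (concreteMap L I u) (concreteMap L I v)
  smul c u := by
    rw [concreteNorm, map_smul]
    exact norm_smul_clm c (concreteMap L I u)
  eq_zero u hu := concreteMap_injective hI ((norm_eq_zero.1 hu).trans (map_zero _).symm)
  left_le b u := by
    simp only [concreteNorm, concreteMap_leftMul]
    exact (ContinuousLinearMap.opNorm_comp_le _ _).trans
      (mul_le_mul_of_nonneg_right (norm_hilbertMap_id_le b) (norm_nonneg _))
  right_le b u := by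
    simp only [concreteNorm, concreteMap_rightMul]
    refine (ContinuousLinearMap.opNorm_comp_le _ _).trans ?_
    rw [mul_comm]
    exact mul_le_mul_of_nonneg_right (norm_hilbertMap_id_le b) (norm_nonneg _)
  add_eq_max P Q u v hP hQ hPQ hPu huP hQv hvQ := by
    have hQP : Q * P = 0 := by
      have := congrArg star hPQ
      rwa [star_mul, hP.isSelfAdjoint.star_eq, hQ.isSelfAdjoint.star_eq, star_zero] at this
    have hu : concreteMap L I u ∘L hilbertMap P (.id ℂ H) = concreteMap L I u := by
      rw [← concreteMap_rightMul, huP]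
    have hv : concreteMap L I v ∘L hilbertMap Q (.id ℂ H) = concreteMap L I v := by
      rw [← concreteMap_rightMul, hvQ]
    unfold concreteNorm
    rw [map_add]
    refine opNorm_add_eq_max (P := hilbertMap P (.id ℂ H)) (Q := hilbertMap Q (.id ℂ H))
      (P' := hilbertMap P (.id ℂ K)) (Q' := hilbertMap Q (.id ℂ K)) (fun x => ?_)
      (inner_hilbertMap_id_of_mul_eq_zero hP hPQ) hu ?_ hv ?_ ?_ ?_ ?_ ?_
    -- `P + Q` is again a projection, hence its amplification is contractive. Pythagoras then gives
    -- the bound on the sum of squares.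
    · have hadd : hilbertMap (P + Q) (.id ℂ H) = hilbertMap P (.id ℂ H) + hilbertMap Q (.id ℂ H) :=
        LinearMap.map_add₂ (hilbertMapₗ L H L H) P Q (.id ℂ H)
      have hle : ‖hilbertMap (P + Q) (.id ℂ H) x‖ ≤ ‖x‖ := by
        refine (ContinuousLinearMap.le_of_opNorm_le _ ((norm_hilbertMap_id_le _).trans
          (hP.add hQ hPQ).norm_le) x).trans (one_mul _).le
      have := norm_add_sq_eq_norm_sq_add_norm_sq_of_inner_eq_zero _ _
        (inner_hilbertMap_id_of_mul_eq_zero (K := H) hP hPQ x x)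
      rw [hadd, add_apply] at hle
      nlinarith [norm_nonneg (hilbertMap P (.id ℂ H) x + hilbertMap Q (.id ℂ H) x)]
    · rw [← concreteMap_leftMul, hPu]
    · rw [← concreteMap_leftMul, hQv]
    · rw [← hv, ContinuousLinearMap.comp_assoc, hilbertMap_id_comp_eq_zero hQP,
        ContinuousLinearMap.comp_zero]
    · rw [← hu, ContinuousLinearMap.comp_assoc, hilbertMap_id_comp_eq_zero hPQ,
        ContinuousLinearMap.comp_zero]
    · exact (norm_hilbertMap_id_le P).trans hP.norm_le
    · exact (norm_hilbertMap_id_le Q).trans hQ.norm_le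

end Concrete

/-! ### Compact operators: adjoints, square roots, finite-rank approximation -/

section Compact

variable {X : Type*} [NormedAddCommGroup X] [InnerProductSpace ℂ X] [CompleteSpace X]

/-- By `‖A x‖² ≤ ‖A* A x‖ ‖x‖`, a net for the image of the unit ball under `A* A` lifts to a net for
its image under `A`. Compactness of adjoints, absolute values and square roots all follow from this.
-/
theorem isCompactOperator_of_star_mul_self {A : X →L[ℂ] X} (h : IsCompactOperator (star A * A)) :
    IsCompactOperator A := by
  have h' : IsCompactOperator (star A * A : X →L[ℂ] X).toLinearMap := h
  rw [isCompactOperator_iff_isCompact_closure_image_closedBall _ one_pos] at h'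
  change IsCompactOperator A.toLinearMap
  rw [isCompactOperator_iff_isCompact_closure_image_closedBall _ one_pos]
  refine TotallyBounded.isCompact_of_isClosed (TotallyBounded.closure ?_) isClosed_closure
  have htb : TotallyBounded ((star A * A : X →L[ℂ] X) '' Metric.closedBall 0 1) :=
    h'.totallyBounded.subset subset_closure
  rw [Metric.totallyBounded_iff]
  intro ε hε
  -- The centres are taken inside the image so that they have preimages in the ball. The radius is
  -- `ε² / 2` because two points of the ball differ by at most `2`.
  obtain ⟨t, hts, htf, htc⟩ := totallyBounded_iff_subset.1 htb _
    (Metric.dist_mem_uniformity (show 0 < ε ^ 2 / 2 by positivity))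
  let g := Function.invFunOn (star A * A : X →L[ℂ] X) (Metric.closedBall 0 1)
  refine ⟨(fun y => A (g y)) '' t, htf.image _, ?_⟩
  rintro _ ⟨x, hx, rfl⟩
  obtain ⟨y, hy, hxy⟩ := Set.mem_iUnion₂.1 (htc ⟨x, hx, rfl⟩)
  refine Set.mem_iUnion₂.2 ⟨A (g y), ⟨y, hy, rfl⟩, ?_⟩
  have hgy : g y ∈ Metric.closedBall (0 : X) 1 := Function.invFunOn_mem (hts hy)
  have hgy' : (star A * A : X →L[ℂ] X) (g y) = y := Function.invFunOn_eq (hts hy)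
  replace hxy : dist ((star A * A : X →L[ℂ] X) x) y < ε ^ 2 / 2 := hxy
  rw [← hgy', dist_eq_norm, ← map_sub] at hxy
  rw [mem_closedBall_zero_iff] at hx hgy
  have hn : ‖x - g y‖ ≤ 2 := (norm_sub_le _ _).trans (by linarith)
  have key : ‖A (x - g y)‖ ^ 2 < ε ^ 2 := by
    calc ‖A (x - g y)‖ ^ 2 = RCLike.re (inner ℂ ((star A * A : X →L[ℂ] X) (x - g y)) (x - g y)) :=
          A.apply_norm_sq_eq_inner_adjoint_left _
      _ ≤ ‖(star A * A : X →L[ℂ] X) (x - g y)‖ * ‖x - g y‖ := re_inner_le_norm _ _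
      _ ≤ ‖(star A * A : X →L[ℂ] X) (x - g y)‖ * 2 := by gcongr
      _ < ε ^ 2 / 2 * 2 := by gcongr
      _ = ε ^ 2 := by ring
  rw [Metric.mem_ball, dist_eq_norm]
  change ‖A x - A (g y)‖ < ε
  rw [← map_sub]
  exact (sq_lt_sq₀ (norm_nonneg _) hε.le).1 key

theorem isCompactOperator_star {A : X →L[ℂ] X} (h : IsCompactOperator A) :
    IsCompactOperator (star A : X →L[ℂ] X) := by
  refine isCompactOperator_of_star_mul_self ?_
  rw [star_star]
  exact h.comp_clm _

theorem isCompactOperator_abs {A : X →L[ℂ] X} (h : IsCompactOperator A) :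
    IsCompactOperator (CFC.abs A : X →L[ℂ] X) := by
  refine isCompactOperator_of_star_mul_self ?_
  rw [(CFC.abs_nonneg A).isSelfAdjoint.star_eq, CFC.abs_mul_abs]
  exact h.clm_comp (star A)

theorem isCompactOperator_sqrt {A : X →L[ℂ] X} (hA : 0 ≤ A) (h : IsCompactOperator A) :
    IsCompactOperator (CFC.sqrt A : X →L[ℂ] X) := by
  refine isCompactOperator_of_star_mul_self ?_
  rw [(CFC.sqrt_nonneg A).isSelfAdjoint.star_eq, CFC.sqrt_mul_sqrt_self A hA]
  exact h

theorem norm_sqrt_mul_norm_sqrt {A : X →L[ℂ] X} (hA : 0 ≤ A) :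
    ‖CFC.sqrt A‖ * ‖CFC.sqrt A‖ = ‖A‖ := by
  rw [← CStarRing.norm_star_mul_self, (CFC.sqrt_nonneg A).isSelfAdjoint.star_eq,
    CFC.sqrt_mul_sqrt_self A hA]

theorem mem_compactOperator_posPart {A : X →L[ℂ] X} (hA : IsSelfAdjoint A) (h : A ∈ Cpt X) :
    A⁺ ∈ Cpt X := by
  have : A⁺ = (2⁻¹ : ℂ) • (CFC.abs A + A) := by
    rw [CFC.abs_add_self A, two_smul, ← two_smul ℂ, inv_smul_smul₀ two_ne_zero]
  rw [this]
  exact (Cpt X).smul_mem _ ((Cpt X).add_mem (isCompactOperator_abs h) h)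

theorem exists_nonneg_decomposition_of_isCompactOperator {A : X →L[ℂ] X} (h : A ∈ Cpt X) :
    ∃ B : Fin 4 → X →L[ℂ] X, (∀ i, 0 ≤ B i) ∧ (∀ i, B i ∈ Cpt X) ∧ (∀ i, ‖B i‖ ≤ ‖A‖) ∧
      A = ∑ i : Fin 4, Complex.I ^ (i : ℕ) • B i := by
  have hs : star A ∈ Cpt X := isCompactOperator_star h
  have hre : (realPart A : X →L[ℂ] X) ∈ Cpt X := by
    rw [realPart_apply_coe]
    exact ((Cpt X).restrictScalars ℝ).smul_mem (2⁻¹ : ℝ) ((Cpt X).add_mem h hs)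
  have him : (imaginaryPart A : X →L[ℂ] X) ∈ Cpt X := by
    rw [imaginaryPart_apply_coe]
    exact (Cpt X).smul_mem (-Complex.I) 
      (((Cpt X).restrictScalars ℝ).smul_mem (2⁻¹ : ℝ) ((Cpt X).sub_mem h hs))
  have hneg {B : X →L[ℂ] X} (hB : IsSelfAdjoint B) (hc : B ∈ Cpt X) : B⁻ ∈ Cpt X := by
    rw [← CFC.posPart_neg]
    exact mem_compactOperator_posPart hB.neg ((Cpt X).neg_mem hc)
  -- The order matches the coefficients `1, i, -1, -i`.
  refine ⟨![(realPart A : X →L[ℂ] X)⁺, (imaginaryPart A : X →L[ℂ] X)⁺,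
    (realPart A : X →L[ℂ] X)⁻, (imaginaryPart A : X →L[ℂ] X)⁻], ?_, ?_, ?_, ?_⟩
  · intro i
    fin_cases i
    · exact CFC.posPart_nonneg _
    · exact CFC.posPart_nonneg _
    · exact CFC.negPart_nonneg _
    · exact CFC.negPart_nonneg _
  · intro i
    fin_cases i
    · exact mem_compactOperator_posPart (realPart A).2 hre
    · exact mem_compactOperator_posPart (imaginaryPart A).2 him
    · exact hneg (realPart A).2 hre
    · exact hneg (imaginaryPart A).2 him
  · intro i
    fin_cases i
    · exact (CStarAlgebra.norm_posPart_le _).trans (realPart.norm_le A)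
    · exact (CStarAlgebra.norm_posPart_le _).trans (imaginaryPart.norm_le A)
    · exact (CStarAlgebra.norm_negPart_le _).trans (realPart.norm_le A)
    · exact (CStarAlgebra.norm_negPart_le _).trans (imaginaryPart.norm_le A)
  · nth_rw 1 [← CStarAlgebra.linear_combination_nonneg A]
    simp only [Fin.sum_univ_four, Fin.coe_ofNat_eq_mod, Matrix.cons_val, Nat.reduceMod,
      Complex.I_sq, Complex.I_pow_three]
    module

/-- `V` is spanned by a `δ`-net `t` of the image of the unit ball: for `y` in `t`, the complementary
projection kills `y`, so it maps `A x` to the image of `A x - y`. Allowing every `W ≥ V` lets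
finitely many operators share one projection. -/
theorem exists_norm_sub_starProjection_le {A : X →L[ℂ] X} (h : IsCompactOperator A) {δ : ℝ}
    (hδ : 0 < δ) : ∃ V : Submodule ℂ X, FiniteDimensional ℂ V ∧
      ∀ W : Submodule ℂ X, V ≤ W → ∀ [W.HasOrthogonalProjection],
        ‖A - W.starProjection * A‖ ≤ δ := by
  have h' : IsCompactOperator A.toLinearMap := h
  rw [isCompactOperator_iff_isCompact_closure_image_closedBall _ one_pos] at h'
  have htb : TotallyBounded (A '' Metric.closedBall 0 1) :=
    h'.totallyBounded.subset subset_closure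
  obtain ⟨t, htf, htc⟩ := Metric.totallyBounded_iff.1 htb δ hδ
  refine ⟨Submodule.span ℂ t, FiniteDimensional.span_of_finite ℂ htf, fun W hW _ => ?_⟩
  refine ContinuousLinearMap.opNorm_le_of_unit_norm hδ.le fun x hx => ?_
  obtain ⟨y, hy, hxy⟩ := Set.mem_iUnion₂.1 (htc ⟨x, by simp [hx], rfl⟩)
  have hyW : y ∈ W := hW (Submodule.subset_span hy)
  have hz : A x - W.starProjection (A x) = (1 - W.starProjection) (A x - y) := by
    rw [map_sub, sub_apply, sub_apply, one_apply_eq_self, one_apply_eq_self,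
      W.starProjection_eq_self_iff.2 hyW, sub_self, sub_zero]
  change ‖A x - W.starProjection (A x)‖ ≤ δ
  rw [hz]
  refine (ContinuousLinearMap.le_of_opNorm_le _
    (isStarProjection_starProjection (U := W)).one_sub.norm_le _).trans ?_
  rw [one_mul, ← dist_eq_norm]
  exact (Metric.mem_ball.1 hxy).le

end Compact

/-- Infinite dimension supplies `dim Y` independent vectors in `X`; Gram–Schmidt makes them
orthonormal. -/
theorem exists_linearIsometry_of_finiteDimensional {X Y : Type*} [NormedAddCommGroup X]
    [InnerProductSpace ℂ X] [NormedAddCommGroup Y]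
    [InnerProductSpace ℂ Y] [FiniteDimensional ℂ Y] (hX : ¬ FiniteDimensional ℂ X) :
    Nonempty (Y →ₗᵢ[ℂ] X) := by
  have hr : (Module.finrank ℂ Y : Cardinal) ≤ Module.rank ℂ X :=
    (Cardinal.natCast_lt_aleph0.le).trans
      (not_lt.1 fun hlt => hX (Module.rank_lt_aleph0_iff.1 hlt))
  obtain ⟨f, hf⟩ := exists_linearIndependent_of_le_rank hr
  have ho := InnerProductSpace.gramSchmidtNormed_orthonormal hf
  let o := stdOrthonormalBasis ℂ Y
  refine ⟨(o.toBasis.constr ℂ (InnerProductSpace.gramSchmidtNormed ℂ f)).isometryOfOrthonormal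
    (v := o.toBasis) (by simp) ?_⟩
  convert ho using 1
  ext i
  simp

open ConjSpace

/-! ### Slicing operators into column and row elements -/

section Factor

variable {L H : Type*} [NormedAddCommGroup L] [InnerProductSpace ℂ L]
  [NormedAddCommGroup H] [InnerProductSpace ℂ H]

variable (L) in
/-- The operator `ξ ↦ ξ ⊗ e`. -/
def insertVec (e : H) : L →L[ℂ] HilbertTensor L H :=
  LinearMap.mkContinuous
    { toFun := fun ξ => ((ξ ⊗ₜ[ℂ] e : L ⊗[ℂ] H) : HilbertTensor L H)
      map_add' := fun ξ η => by rw [TensorProduct.add_tmul, UniformSpace.Completion.coe_add]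
      map_smul' := fun c ξ => by
        rw [← TensorProduct.smul_tmul', UniformSpace.Completion.coe_smul, RingHom.id_apply] }
    ‖e‖ fun ξ => by
      change ‖((ξ ⊗ₜ[ℂ] e : L ⊗[ℂ] H) : HilbertTensor L H)‖ ≤ _
      rw [UniformSpace.Completion.norm_coe, TensorProduct.norm_tmul, mul_comm]

theorem insertVec_apply (e : H) (ξ : L) :
    insertVec L e ξ = ((ξ ⊗ₜ[ℂ] e : L ⊗[ℂ] H) : HilbertTensor L H) := rfl

theorem norm_insertVec_le (e : H) : ‖insertVec L e‖ ≤ ‖e‖ :=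
  LinearMap.mkContinuous_norm_le _ (norm_nonneg _) _

theorem norm_hilbertMap_starProjection_le (V : Submodule ℂ H) [V.HasOrthogonalProjection] :
    ‖hilbertMap (.id ℂ L) V.starProjection‖ ≤ 1 :=
  (norm_hilbertMap_le _ _).trans (mul_le_one₀ ContinuousLinearMap.norm_id_le (norm_nonneg _)
    V.starProjection_norm_le)

variable [CompleteSpace L]

theorem adjoint_insertVec_tmul (e : H) (ξ : L) (h : H) :
    ContinuousLinearMap.adjoint (insertVec L e) ((ξ ⊗ₜ[ℂ] h : L ⊗[ℂ] H) : HilbertTensor L H) =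
      inner ℂ e h • ξ := by
  refine ext_inner_left ℂ fun η => ?_
  rw [ContinuousLinearMap.adjoint_inner_right, insertVec_apply, UniformSpace.Completion.inner_coe,
    TensorProduct.inner_tmul, inner_smul_right, mul_comm]

theorem adjoint_insertVec_comp_insertVec {e : H} (he : ‖e‖ = 1) :
    ContinuousLinearMap.adjoint (insertVec L e) ∘L insertVec L e = .id ℂ L := by
  ext ξ
  rw [ContinuousLinearMap.comp_apply, insertVec_apply, adjoint_insertVec_tmul,
    inner_self_eq_norm_sq_to_K, he]
  simp

/-- Each summand is the identity of `L` tensored with the projection onto one basis vector. -/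
theorem sum_insertVec_comp_adjoint (V : Submodule ℂ H) [V.HasOrthogonalProjection]
    {ι : Type*} [Fintype ι] (o : OrthonormalBasis ι ℂ V) :
    ∑ i, insertVec L (o i : H) ∘L ContinuousLinearMap.adjoint (insertVec L (o i : H)) =
      hilbertMap (.id ℂ L) V.starProjection := by
  refine clm_ext_tmul fun ξ h => ?_
  rw [hilbertMap_tmul, o.starProjection_eq_sum_rankOne, ContinuousLinearMap.id_apply]
  simp only [sum_apply, ContinuousLinearMap.comp_apply, adjoint_insertVec_tmul, insertVec_apply,
    InnerProductSpace.rankOne_apply, TensorProduct.tmul_sum, TensorProduct.tmul_smul,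
    TensorProduct.smul_tmul]
  exact (map_sum (UniformSpace.Completion.toComplL (𝕜 := ℂ) (E := L ⊗[ℂ] H)) _ _).symm

/-- The element `∑ i, (J i)* B ⊗ e i` of `𝒦H`, where `J i = insertVec L (e i)`. -/
def colElem {ι : Type*} [Fintype ι] (e : ι → H) {B : L →L[ℂ] HilbertTensor L H}
    (hB : IsCompactOperator B) : Amp L H :=
  ∑ i, (⟨ContinuousLinearMap.adjoint (insertVec L (e i)) ∘L B,
    IsCompactOperator.clm_comp hB (ContinuousLinearMap.adjoint (insertVec L (e i)))⟩ : Cpt L) ⊗ₜ e i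

/-- The element `∑ i, C (J i) ⊗ conj (e i)` of `𝒦H̄`, where `J i = insertVec L (e i)`. -/
def rowElem {ι : Type*} [Fintype ι] (e : ι → H) {C : HilbertTensor L H →L[ℂ] L}
    (hC : IsCompactOperator C) : Amp L (ConjSpace H) :=
  ∑ i, (⟨C ∘L insertVec L (e i), hC.comp_clm _⟩ : Cpt L) ⊗ₜ conj H (e i)

/-- For an orthonormal basis of `V` the sum is the projection onto `L ⊗ V`, so the column element
represents `B` compressed to that subspace, with `L ⊗ ℂ` identified with `L`. -/
theorem concreteMap_colElem {ι : Type*} [Fintype ι] (e : ι → H) {B : L →L[ℂ] HilbertTensor L H}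
    (hB : IsCompactOperator B) :
    concreteMap L (colEmb H) (colElem e hB) =
      (∑ i, insertVec L (e i) ∘L ContinuousLinearMap.adjoint (insertVec L (e i))) ∘L B ∘L
        ContinuousLinearMap.adjoint (insertVec L (1 : ℂ)) := by
  refine clm_ext_tmul fun ξ c => ?_
  simp only [colElem, map_sum, concreteMap_tmul, sum_apply, ContinuousLinearMap.comp_apply,
    hilbertMap_tmul, adjoint_insertVec_tmul, colEmb_apply, insertVec_apply]
  refine Finset.sum_congr rfl fun i _ => ?_
  rw [TensorProduct.tmul_smul, TensorProduct.smul_tmul', ← map_smul, ← map_smul]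
  simp

/-- The canonical identification of `H` with its double conjugate. -/
def conjConj (H : Type*) [NormedAddCommGroup H] [InnerProductSpace ℂ H] :
    H ≃ₗᵢ[ℂ] ConjSpace (ConjSpace H) where
  toFun x := conj (ConjSpace H) (conj H x)
  invFun x := (conj H).symm ((conj (ConjSpace H)).symm x)
  map_add' _ _ := rfl
  map_smul' c x := by
    rw [smul_conj, smul_conj, Complex.conj_conj]
    rfl
  left_inv _ := rfl
  right_inv _ := rfl
  norm_map' _ := rfl

theorem rowEmb_conjConj (x : H) (h : H) :
    rowEmb (ConjSpace H) (conj H x) (conjConj H h) = inner ℂ x h := rfl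

theorem concreteMap_rowElem {ι : Type*} [Fintype ι] (e : ι → H) {C : HilbertTensor L H →L[ℂ] L}
    (hC : IsCompactOperator C) :
    concreteMap L (rowEmb (ConjSpace H)) (rowElem e hC) =
      insertVec L (1 : ℂ) ∘L C ∘L
        (∑ i, insertVec L (e i) ∘L ContinuousLinearMap.adjoint (insertVec L (e i))) ∘L
        hilbertMap (.id ℂ L) ((conjConj H).symm : ConjSpace (ConjSpace H) →L[ℂ] H) := by
  refine clm_ext_tmul fun ξ h => ?_
  obtain ⟨h, rfl⟩ := (conjConj H).surjective h
  simp only [rowElem, map_sum, concreteMap_tmul, sum_apply, ContinuousLinearMap.comp_apply,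
    hilbertMap_tmul, rowEmb_conjConj, ContinuousLinearEquiv.coe_coe,
    LinearIsometryEquiv.coe_toContinuousLinearEquiv, LinearIsometryEquiv.symm_apply_apply,
    adjoint_insertVec_tmul, ContinuousLinearMap.id_apply, map_smul]
  refine Finset.sum_congr rfl fun i _ => ?_
  rw [insertVec_apply (1 : ℂ), ← UniformSpace.Completion.coe_smul, ← TensorProduct.tmul_smul]
  simp

end Factor

/-! ### Finite-rank operators as tensors -/

section FiniteRank

variable {L H : Type*} [NormedAddCommGroup L] [InnerProductSpace ℂ L]
  [NormedAddCommGroup H] [InnerProductSpace ℂ H]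

variable (H) in
/-- The linear map `H ⊗ H̄ → ℬ(H)` with `x ⊗ ȳ ↦ ⟨·, y⟩ x`. -/
def rankOneLift : H ⊗[ℂ] ConjSpace H →ₗ[ℂ] (H →L[ℂ] H) :=
  TensorProduct.lift (LinearMap.mk₂ ℂ
    (fun x y => InnerProductSpace.rankOne ℂ x ((conj H).symm y))
    (fun x x' y => by simp)
    (fun c x y => by simp)
    (fun x y y' => by simp)
    (fun c x y => by
      obtain ⟨y, rfl⟩ := (conj H).surjective y
      rw [smul_conj]
      simp))

theorem rankOneLift_tmul (x y : H) :
    rankOneLift H (x ⊗ₜ conj H y) = InnerProductSpace.rankOne ℂ x y := rfl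

theorem conj_tensor_induction {p : H ⊗[ℂ] ConjSpace H → Prop} (h0 : p 0)
    (ht : ∀ x y : H, p (x ⊗ₜ conj H y)) (ha : ∀ z w, p z → p w → p (z + w)) (z) : p z := by
  induction z using TensorProduct.induction_on with
  | zero => exact h0
  | tmul x y => exact ht x ((conj H).symm y)
  | add z w hz hw => exact ha z w hz hw

/-- The operator of `z` determines all slices of `z` in its first leg, which yields injectivity of
`rankOneLift`. -/
theorem rowEmb_lid_rTensor (ξ η : H) (z : H ⊗[ℂ] ConjSpace H) :
    rowEmb (ConjSpace H) (TensorProduct.lid ℂ _ ((innerSL ℂ ξ).toLinearMap.rTensor _ z))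
      (conjConj H η) = inner ℂ ξ (rankOneLift H z η) := by
  induction z using conj_tensor_induction with
  | h0 => simp
  | ht x y =>
    rw [rankOneLift_tmul]
    simp [rowEmb_conjConj, mul_comm]
  | ha z w hz hw => simp only [map_add, add_apply, inner_add_right, hz, hw]

theorem rowEmb_injective : Function.Injective (rowEmb H) := by
  intro x y hxy
  refine ext_inner_left ℂ fun z => ?_
  rw [← rowEmb_apply, hxy, rowEmb_apply]

theorem rankOneLift_injective : Function.Injective (rankOneLift H) := by
  intro z w hzw
  refine tensor_ext_of_separating (S := Set.range fun ξ : H => (innerSL ℂ ξ).toLinearMap)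
    (fun x y hxy => ext_inner_left ℂ fun ξ => hxy _ ⟨ξ, rfl⟩) ?_
  rintro _ ⟨ξ, rfl⟩
  refine rowEmb_injective (ContinuousLinearMap.ext fun η => ?_)
  obtain ⟨η, rfl⟩ := (conjConj H).surjective η
  rw [rowEmb_lid_rTensor, hzw, rowEmb_lid_rTensor]

theorem rankOneLift_mem_finiteRank (z : H ⊗[ℂ] ConjSpace H) : rankOneLift H z ∈ finiteRank H := by
  induction z using conj_tensor_induction with
  | h0 => rw [map_zero]; exact zero_mem _
  | ht x y =>
    change FiniteDimensional ℂ (LinearMap.range (InnerProductSpace.rankOne ℂ x y).toLinearMap)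
    refine Submodule.finiteDimensional_of_le (S₂ := ℂ ∙ x) ?_
    rintro _ ⟨z, rfl⟩
    exact Submodule.smul_mem _ _ (Submodule.mem_span_singleton_self x)
  | ha z w hz hw => rw [map_add]; exact add_mem hz hw

/-- Expand `T x` in an orthonormal basis `o` of the range: `⟪o i, T x⟫ = ⟪T* (o i), x⟫`, which tells
the second legs. The adjoint is where completeness of `H` enters. -/
theorem exists_rankOneLift_eq [CompleteSpace H] {T : H →L[ℂ] H} (hT : T ∈ finiteRank H) :
    ∃ z, rankOneLift H z = T := by
  have : FiniteDimensional ℂ (LinearMap.range T.toLinearMap) := hT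
  let o := stdOrthonormalBasis ℂ (LinearMap.range T.toLinearMap)
  refine ⟨∑ i, (o i : H) ⊗ₜ conj H (ContinuousLinearMap.adjoint T (o i : H)), ?_⟩
  ext x
  have hx : (LinearMap.range T.toLinearMap).starProjection (T x) = T x :=
    Submodule.starProjection_eq_self_iff.2 ⟨x, rfl⟩
  rw [o.starProjection_eq_sum_rankOne] at hx
  rw [← hx]
  simp [rankOneLift_tmul, sum_apply, ContinuousLinearMap.adjoint_inner_left]

variable (H) in
/-- The linear isomorphism `H ⊗ H̄ ≃ ℱ(H)` with `x ⊗ ȳ ↦ ⟨·, y⟩ x`. -/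
def rankOneEquiv [CompleteSpace H] : (H ⊗[ℂ] ConjSpace H) ≃ₗ[ℂ] finiteRank H :=
  LinearEquiv.ofBijective ((rankOneLift H).codRestrict _ rankOneLift_mem_finiteRank)
    ⟨fun _ _ h => rankOneLift_injective (congrArg Subtype.val h), fun T =>
      (exists_rankOneLift_eq T.2).imp fun _ h => Subtype.ext h⟩

theorem subtype_comp_rankOneEquiv [CompleteSpace H] :
    (finiteRank H).subtype ∘ₗ (rankOneEquiv H).toLinearMap = rankOneLift H := rfl

theorem hilbertMap_mem_finiteRank {a : L →L[ℂ] L} {S : H →L[ℂ] H}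
    (ha : a ∈ finiteRank L) (hS : S ∈ finiteRank H) :
    hilbertMap a S ∈ finiteRank (HilbertTensor L H) := by
  have : FiniteDimensional ℂ (LinearMap.range a.toLinearMap) := ha
  have : FiniteDimensional ℂ (LinearMap.range S.toLinearMap) := hS
  let N : Submodule ℂ (HilbertTensor L H) :=
    (LinearMap.range (TensorProduct.mapIncl (LinearMap.range a.toLinearMap)
      (LinearMap.range S.toLinearMap))).map
        (UniformSpace.Completion.toComplL (𝕜 := ℂ) (E := L ⊗[ℂ] H)).toLinearMap
  refine Submodule.finiteDimensional_of_le (S₂ := N) ?_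
  rintro _ ⟨x, rfl⟩
  refine hilbertTensor_induction (p := fun x => hilbertMap a S x ∈ N) ?_ ?_ ?_ ?_ x
  -- Being finite-dimensional, `N` is closed, so completing the tensor product adds nothing to the
  -- range.
  · exact N.closed_of_finiteDimensional.preimage (hilbertMap a S).continuous
  · rw [map_zero]; exact N.zero_mem
  · intro x y hx hy
    rw [map_add]; exact N.add_mem hx hy
  · intro ξ η
    rw [hilbertMap_tmul]
    exact ⟨_, ⟨(⟨a ξ, ξ, rfl⟩ : LinearMap.range a.toLinearMap) ⊗ₜ
      (⟨S η, η, rfl⟩ : LinearMap.range S.toLinearMap), rfl⟩, rfl⟩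

theorem concreteMap_mem_finiteRank {p : L →L[ℂ] L} (hp : p ∈ finiteRank L)
    (U : Amp L (H ⊗[ℂ] ConjSpace H)) :
    concreteMap L (rankOneLift H) (leftMul p U) ∈ finiteRank (HilbertTensor L H) := by
  induction U using TensorProduct.induction_on with
  | zero => rw [map_zero, map_zero]; exact zero_mem _
  | tmul a z =>
    refine hilbertMap_mem_finiteRank ?_ (rankOneLift_mem_finiteRank z)
    have : FiniteDimensional ℂ (LinearMap.range p.toLinearMap) := hp
    refine Submodule.finiteDimensional_of_le (S₂ := LinearMap.range p.toLinearMap) ?_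
    rintro _ ⟨x, rfl⟩
    exact ⟨a.1 x, rfl⟩
  | add u v hu hv => rw [map_add, map_add]; exact add_mem hu hv

theorem exists_starProjection_rankOneLift (z : H ⊗[ℂ] ConjSpace H) :
    ∃ V : Submodule ℂ H, FiniteDimensional ℂ V ∧ ∀ W : Submodule ℂ H, V ≤ W →
      ∀ [W.HasOrthogonalProjection], W.starProjection ∘L rankOneLift H z = rankOneLift H z ∧
        rankOneLift H z ∘L W.starProjection = rankOneLift H z := by
  induction z using conj_tensor_induction with
  | h0 => exact ⟨⊥, inferInstance, fun W _ _ => by simp⟩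
  | ht x y =>
    refine ⟨Submodule.span ℂ {x, y}, FiniteDimensional.span_of_finite ℂ (by simp),
      fun W hW _ => ?_⟩
    have hx : W.starProjection x = x :=
      Submodule.starProjection_eq_self_iff.2 (hW (Submodule.subset_span (by simp)))
    have hy : W.starProjection y = y :=
      Submodule.starProjection_eq_self_iff.2 (hW (Submodule.subset_span (by simp)))
    rw [rankOneLift_tmul]
    constructor
    · ext z
      simp [hx]
    · ext z
      simp [← W.inner_starProjection_left_eq_right, hy]
  | ha z w hz hw =>
    obtain ⟨V, hV, h⟩ := hz
    obtain ⟨V', hV', h'⟩ := hw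
    refine ⟨V ⊔ V', inferInstance, fun W hW _ => ?_⟩
    obtain ⟨h₁, h₂⟩ := h W (le_sup_left.trans hW)
    obtain ⟨h₁', h₂'⟩ := h' W (le_sup_right.trans hW)
    rw [map_add, ContinuousLinearMap.comp_add, ContinuousLinearMap.add_comp, h₁, h₂, h₁', h₂']
    exact ⟨rfl, rfl⟩

/-- An algebraic tensor involves only finitely many vectors of `H`. Quantifying over all `W ≥ V`
makes the induction step a join of subspaces. -/
theorem exists_starProjection_concreteMap (U : Amp L (H ⊗[ℂ] ConjSpace H)) :
    ∃ V : Submodule ℂ H, FiniteDimensional ℂ V ∧ ∀ W : Submodule ℂ H, V ≤ W →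
      ∀ [W.HasOrthogonalProjection],
        hilbertMap (.id ℂ L) W.starProjection ∘L concreteMap L (rankOneLift H) U =
          concreteMap L (rankOneLift H) U ∧
        concreteMap L (rankOneLift H) U ∘L hilbertMap (.id ℂ L) W.starProjection =
          concreteMap L (rankOneLift H) U := by
  induction U using TensorProduct.induction_on with
  | zero => exact ⟨⊥, inferInstance, fun W _ _ => by simp⟩
  | tmul a z =>
    obtain ⟨V, hV, h⟩ := exists_starProjection_rankOneLift z
    refine ⟨V, hV, fun W hW _ => ?_⟩
    obtain ⟨h₁, h₂⟩ := h W hW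
    rw [concreteMap_tmul, hilbertMap_comp, hilbertMap_comp, h₁, h₂, ContinuousLinearMap.id_comp,
      ContinuousLinearMap.comp_id]
    exact ⟨rfl, rfl⟩
  | add u v hu hv =>
    obtain ⟨V, hV, h⟩ := hu
    obtain ⟨V', hV', h'⟩ := hv
    refine ⟨V ⊔ V', inferInstance, fun W hW _ => ?_⟩
    obtain ⟨h₁, h₂⟩ := h W (le_sup_left.trans hW)
    obtain ⟨h₁', h₂'⟩ := h' W (le_sup_right.trans hW)
    rw [map_add, ContinuousLinearMap.comp_add, ContinuousLinearMap.add_comp, h₁, h₂, h₁', h₂']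
    exact ⟨rfl, rfl⟩

end FiniteRank

/-! ### Computing the Haagerup norm -/

section Haagerup

variable {L H : Type*} [NormedAddCommGroup L] [InnerProductSpace ℂ L]
  [NormedAddCommGroup H] [InnerProductSpace ℂ H]

theorem concreteMap_effros (u : Amp L H) (v : Amp L (ConjSpace H)) :
    concreteMap L (rankOneLift H) (effros u v) =
      concreteMap L (colEmb H) u ∘L concreteMap L (rowEmb (ConjSpace H)) v ∘L
        hilbertMap (.id ℂ L) ((conjConj H : H →L[ℂ] ConjSpace (ConjSpace H))) := by
  induction u using TensorProduct.induction_on with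
  | zero => simp [effros]
  | add u u' hu hu' =>
    have : effros (u + u') v = effros u v + effros u' v := LinearMap.map_add₂ _ _ _ _
    rw [this, map_add, map_add, hu, hu', ContinuousLinearMap.add_comp]
  | tmul a x =>
    induction v using TensorProduct.induction_on with
    | zero => simp [effros]
    | add v v' hv hv' =>
      have : effros (a ⊗ₜ x) (v + v') = effros (a ⊗ₜ x) v + effros (a ⊗ₜ[ℂ] x) v' :=
        map_add _ _ _
      rw [this, map_add, map_add, hv, hv', ContinuousLinearMap.add_comp,
        ContinuousLinearMap.comp_add]
    | tmul b y =>
      obtain ⟨y, rfl⟩ := (conj H).surjective y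
      rw [effros_tmul, concreteMap_tmul, concreteMap_tmul, concreteMap_tmul, hilbertMap_comp,
        hilbertMap_comp, ContinuousLinearMap.comp_id]
      rfl

theorem norm_hilbertMap_id_isometry_le {X Y : Type*} [NormedAddCommGroup X]
    [InnerProductSpace ℂ X] [NormedAddCommGroup Y] [InnerProductSpace ℂ Y] (f : X ≃ₗᵢ[ℂ] Y) :
    ‖hilbertMap (.id ℂ L) (f : X →L[ℂ] Y)‖ ≤ 1 :=
  (norm_hilbertMap_le _ _).trans (mul_le_one₀ ContinuousLinearMap.norm_id_le (norm_nonneg _)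
    f.toLinearIsometry.norm_toContinuousLinearMap_le)

theorem norm_concreteMap_effros_le (u : Amp L H) (v : Amp L (ConjSpace H)) :
    ‖concreteMap L (rankOneLift H) (effros u v)‖ ≤
      colNorm L H u * rowNorm L (ConjSpace H) v := by
  rw [concreteMap_effros]
  refine (ContinuousLinearMap.opNorm_comp_le _ _).trans ?_
  refine mul_le_mul_of_nonneg_left ?_ (norm_nonneg _)
  refine (ContinuousLinearMap.opNorm_comp_le _ _).trans ?_
  exact mul_le_of_le_one_right (norm_nonneg _) (norm_hilbertMap_id_isometry_le _)

variable (L) in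
/-- `U` has a decomposition `∑ u k ⊙ v k` in `𝒦(H_c ⊗ H̄_r)` of total size at most `r`. -/
def HasHaagerupDecomposition (U : Amp L (H ⊗[ℂ] ConjSpace H)) (r : ℝ) : Prop :=
  ∃ (n : ℕ) (u : Fin n → Amp L H) (v : Fin n → Amp L (ConjSpace H)),
    U = ∑ k, effros (u k) (v k) ∧ ∑ k, colNorm L H (u k) * rowNorm L (ConjSpace H) (v k) ≤ r

theorem HasHaagerupDecomposition.add {U V : Amp L (H ⊗[ℂ] ConjSpace H)} {r s : ℝ}
    (hU : HasHaagerupDecomposition L U r) (hV : HasHaagerupDecomposition L V s) :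
    HasHaagerupDecomposition L (U + V) (r + s) := by
  obtain ⟨n, u, v, rfl, hr⟩ := hU
  obtain ⟨m, u', v', rfl, hs⟩ := hV
  refine ⟨n + m, Fin.append u u', Fin.append v v', ?_, ?_⟩
  · simp [Fin.sum_univ_add]
  · simpa [Fin.sum_univ_add] using add_le_add hr hs

theorem HasHaagerupDecomposition.mono {U : Amp L (H ⊗[ℂ] ConjSpace H)} {r s : ℝ}
    (hU : HasHaagerupDecomposition L U r) (h : r ≤ s) : HasHaagerupDecomposition L U s := by
  obtain ⟨n, u, v, hU, hr⟩ := hU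
  exact ⟨n, u, v, hU, hr.trans h⟩

theorem HasHaagerupDecomposition.zero :
    HasHaagerupDecomposition L (0 : Amp L (H ⊗[ℂ] ConjSpace H)) 0 :=
  ⟨0, Fin.elim0, Fin.elim0, by simp, by simp⟩

theorem colNorm_tmul_le (a : Cpt L) (x : H) : colNorm L H (a ⊗ₜ x) ≤ ‖a.1‖ * ‖x‖ := by
  refine (norm_hilbertMap_le _ _).trans_eq ?_
  congr 1
  exact ContinuousLinearMap.norm_toSpanSingleton x

theorem rowNorm_tmul_le (a : Cpt L) (x : H) : rowNorm L H (a ⊗ₜ x) ≤ ‖a.1‖ * ‖x‖ := by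
  refine (norm_hilbertMap_le _ _).trans_eq ?_
  congr 1
  exact innerSL_apply_norm (𝕜 := ℂ) (conj H x)

theorem leftMul_add_leftMul_one_sub {E : Type*} [AddCommGroup E] [Module ℂ E] (p : L →L[ℂ] L)
    (U : Amp L E) : leftMul p U + leftMul (1 - p) U = U := by
  induction U using TensorProduct.induction_on with
  | zero => rw [map_zero, map_zero, add_zero]
  | tmul a x =>
    change cptLeft p a ⊗ₜ[ℂ] x + cptLeft (1 - p) a ⊗ₜ[ℂ] x = a ⊗ₜ[ℂ] x
    rw [← TensorProduct.add_tmul]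
    congr 1
    refine Subtype.ext ?_
    change p * a.1 + (1 - p) * a.1 = a.1
    rw [← add_mul, add_sub_cancel, one_mul]
  | add u v hu hv => rw [map_add, map_add, add_add_add_comm, hu, hv]

theorem concreteNorm_nonneg {E K : Type*} [AddCommGroup E] [Module ℂ E] [NormedAddCommGroup K]
    [InnerProductSpace ℂ K] (I : E →ₗ[ℂ] (H →L[ℂ] K)) (u : Amp L E) : 0 ≤ concreteNorm L I u :=
  norm_nonneg (concreteMap L I u)

variable [CompleteSpace L]

/-- Both factors of a decomposition need compact coefficients. A positive compact operator is the
square of its compact square root, and four such pieces make up `a`. The constant `4` is harmless,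
since the bound is only used on small remainders. -/
theorem hasHaagerupDecomposition_tmul (a : Cpt L) (x y : H) :
    HasHaagerupDecomposition L (a ⊗ₜ (x ⊗ₜ conj H y)) (4 * (‖a.1‖ * ‖x‖ * ‖y‖)) := by
  obtain ⟨B, hB0, hBc, hBn, hB⟩ := exists_nonneg_decomposition_of_isCompactOperator a.2
  let R (i : Fin 4) : Cpt L := ⟨CFC.sqrt (B i), isCompactOperator_sqrt (hB0 i) (hBc i)⟩
  refine ⟨4, fun i => (Complex.I ^ (i : ℕ) • R i) ⊗ₜ x, fun i => R i ⊗ₜ conj H y, ?_, ?_⟩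
  · simp only [effros_tmul]
    rw [← TensorProduct.sum_tmul]
    congr 1
    refine Subtype.ext ?_
    rw [hB, Submodule.coe_sum]
    refine Finset.sum_congr rfl fun i _ => ?_
    rw [map_smul]
    change _ = Complex.I ^ (i : ℕ) • (CFC.sqrt (B i) * CFC.sqrt (B i))
    rw [CFC.sqrt_mul_sqrt_self _ (hB0 i)]
  · have key (i : Fin 4) : colNorm L H ((Complex.I ^ (i : ℕ) • R i) ⊗ₜ x) *
        rowNorm L (ConjSpace H) (R i ⊗ₜ conj H y) ≤ ‖a.1‖ * ‖x‖ * ‖y‖ := by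
      have hI : ‖(Complex.I ^ (i : ℕ) • R i).1‖ = ‖CFC.sqrt (B i)‖ := by
        change ‖Complex.I ^ (i : ℕ) • CFC.sqrt (B i)‖ = _
        rw [norm_smul]
        simp
      calc _ ≤ (‖CFC.sqrt (B i)‖ * ‖x‖) * (‖CFC.sqrt (B i)‖ * ‖y‖) := by
            refine mul_le_mul ?_ (rowNorm_tmul_le _ _) (concreteNorm_nonneg _ _) (by positivity)
            rw [← hI]
            exact colNorm_tmul_le _ _
        _ = (‖CFC.sqrt (B i)‖ * ‖CFC.sqrt (B i)‖) * ‖x‖ * ‖y‖ := by ring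
        _ = ‖B i‖ * ‖x‖ * ‖y‖ := by rw [norm_sqrt_mul_norm_sqrt (hB0 i)]
        _ ≤ ‖a.1‖ * ‖x‖ * ‖y‖ := by gcongr; exact hBn i
    refine (Finset.sum_le_card_nsmul _ _ _ fun i _ => key i).trans_eq ?_
    simp

theorem exists_hasHaagerupDecomposition_leftMul_one_sub_tmul (a : Cpt L)
    (z : H ⊗[ℂ] ConjSpace H) : ∀ δ : ℝ, 0 < δ →
    ∃ V : Submodule ℂ L, FiniteDimensional ℂ V ∧ ∀ W : Submodule ℂ L, V ≤ W →
      ∀ [W.HasOrthogonalProjection],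
        HasHaagerupDecomposition L (leftMul (1 - W.starProjection) (a ⊗ₜ z)) δ := by
  induction z using conj_tensor_induction with
  | h0 =>
    intro δ hδ
    refine ⟨⊥, inferInstance, fun W _ _ => ?_⟩
    rw [TensorProduct.tmul_zero, map_zero]
    exact HasHaagerupDecomposition.zero.mono hδ.le
  | ht x y =>
    intro δ hδ
    -- The `+ 1` keeps the divisor positive when `x` or `y` vanishes.
    have hc : 0 < 4 * (‖x‖ * ‖y‖) + 1 := by positivity
    obtain ⟨V, hV, h⟩ := exists_norm_sub_starProjection_le a.2
      (show 0 < δ / (4 * (‖x‖ * ‖y‖) + 1) by positivity)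
    refine ⟨V, hV, fun W hW _ => ?_⟩
    refine (hasHaagerupDecomposition_tmul (cptLeft (1 - W.starProjection) a) x y).mono ?_
    have h1 : ‖(cptLeft (1 - W.starProjection) a).1‖ ≤ δ / (4 * (‖x‖ * ‖y‖) + 1) := by
      change ‖(1 - W.starProjection) * a.1‖ ≤ _
      rw [sub_mul, one_mul]
      exact h W hW
    calc 4 * (‖(cptLeft (1 - W.starProjection) a).1‖ * ‖x‖ * ‖y‖)
        = ‖(cptLeft (1 - W.starProjection) a).1‖ * (4 * (‖x‖ * ‖y‖)) := by ring
      _ ≤ δ / (4 * (‖x‖ * ‖y‖) + 1) * (4 * (‖x‖ * ‖y‖) + 1) := by gcongr; linarith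
      _ = δ := div_mul_cancel₀ _ hc.ne'
  | ha z w hz hw =>
    intro δ hδ
    obtain ⟨V, hV, h⟩ := hz (δ / 2) (by positivity)
    obtain ⟨V', hV', h'⟩ := hw (δ / 2) (by positivity)
    refine ⟨V ⊔ V', inferInstance, fun W hW _ => ?_⟩
    rw [TensorProduct.tmul_add, map_add]
    exact ((h W (le_sup_left.trans hW)).add (h' W (le_sup_right.trans hW))).mono (by linarith)

theorem exists_hasHaagerupDecomposition_leftMul_one_sub (U : Amp L (H ⊗[ℂ] ConjSpace H)) :
    ∀ δ : ℝ, 0 < δ → ∃ V : Submodule ℂ L, FiniteDimensional ℂ V ∧ ∀ W : Submodule ℂ L, V ≤ W →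
      ∀ [W.HasOrthogonalProjection],
        HasHaagerupDecomposition L (leftMul (1 - W.starProjection) U) δ := by
  induction U using TensorProduct.induction_on with
  | zero =>
    intro δ hδ
    refine ⟨⊥, inferInstance, fun W _ _ => ?_⟩
    rw [map_zero]
    exact HasHaagerupDecomposition.zero.mono hδ.le
  | tmul a z => exact exists_hasHaagerupDecomposition_leftMul_one_sub_tmul a z
  | add u v hu hv =>
    intro δ hδ
    obtain ⟨V, hV, h⟩ := hu (δ / 2) (by positivity)
    obtain ⟨V', hV', h'⟩ := hv (δ / 2) (by positivity)
    refine ⟨V ⊔ V', inferInstance, fun W hW _ => ?_⟩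
    rw [map_add]
    exact ((h W (le_sup_left.trans hW)).add (h' W (le_sup_right.trans hW))).mono (by linarith)

/-- With `W` an isometry from the range of `T` into `L`, `C` is `W` after `T`, and `B` is the
adjoint of `W` followed by inclusion. Both pass through a finite-dimensional space, hence are
compact. -/
theorem exists_compact_factorization {M : Type*} [NormedAddCommGroup M] [InnerProductSpace ℂ M]
    (hL : ¬ FiniteDimensional ℂ L) {T : M →L[ℂ] M}
    (hT : T ∈ finiteRank M) : ∃ (B : L →L[ℂ] M) (C : M →L[ℂ] L), IsCompactOperator B ∧
      IsCompactOperator C ∧ B ∘L C = T ∧ ‖B‖ ≤ 1 ∧ ‖C‖ ≤ ‖T‖ := by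
  have : FiniteDimensional ℂ (LinearMap.range T.toLinearMap) := hT
  have : CompleteSpace (LinearMap.range T.toLinearMap) := FiniteDimensional.complete ℂ _
  have : ProperSpace (LinearMap.range T.toLinearMap) := FiniteDimensional.proper ℂ _
  obtain ⟨W⟩ := exists_linearIsometry_of_finiteDimensional
    (Y := LinearMap.range T.toLinearMap) hL
  let W' := W.toContinuousLinearMap
  let T' := T.codRestrict (LinearMap.range T.toLinearMap) fun x => ⟨x, rfl⟩
  have hW : ContinuousLinearMap.adjoint W' ∘L W' = 1 :=
    (ContinuousLinearMap.norm_map_iff_adjoint_comp_self _).1 W.norm_map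
  have hW1 : ‖W'‖ ≤ 1 := W.norm_toContinuousLinearMap_le
  refine ⟨(LinearMap.range T.toLinearMap).subtypeL ∘L ContinuousLinearMap.adjoint W', W' ∘L T',
    ?_, ?_, ?_, ?_, ?_⟩
  · exact (isCompactOperator_of_locallyCompactSpace_dom (ContinuousLinearMap.adjoint W')).clm_comp
      (LinearMap.range T.toLinearMap).subtypeL
  · exact (isCompactOperator_of_locallyCompactSpace_dom T').clm_comp W'
  · ext x
    have := congrArg (fun f => f (T' x)) hW
    exact congrArg Subtype.val this
  · refine (ContinuousLinearMap.opNorm_comp_le _ _).trans ?_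
    rw [LinearIsometryEquiv.norm_map]
    exact mul_le_one₀ (Submodule.norm_subtypeL_le _) (norm_nonneg _) hW1
  · refine (ContinuousLinearMap.opNorm_comp_le _ _).trans ?_
    refine (mul_le_of_le_one_left (norm_nonneg _) hW1).trans ?_
    exact ContinuousLinearMap.opNorm_le_bound _ (norm_nonneg _) fun x => T.le_opNorm x

theorem hasHaagerupDecomposition_of_mem_finiteRank (hL : ¬ FiniteDimensional ℂ L)
    {U : Amp L (H ⊗[ℂ] ConjSpace H)}
    (hU : concreteMap L (rankOneLift H) U ∈ finiteRank (HilbertTensor L H)) :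
    HasHaagerupDecomposition L U ‖concreteMap L (rankOneLift H) U‖ := by
  obtain ⟨B, C, hB, hC, hBC, hB1, hC1⟩ := exists_compact_factorization hL hU
  obtain ⟨V, hV, h⟩ := exists_starProjection_concreteMap U
  obtain ⟨h₁, h₂⟩ := h V le_rfl
  let o := stdOrthonormalBasis ℂ V
  have hcol := concreteMap_colElem (fun i => (o i : H)) hB
  have hrow := concreteMap_rowElem (fun i => (o i : H)) hC
  rw [sum_insertVec_comp_adjoint] at hcol hrow
  have hJ : ‖insertVec L (1 : ℂ)‖ ≤ 1 := (norm_insertVec_le _).trans (by simp)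
  have hQ := norm_hilbertMap_starProjection_le (L := L) V
  refine ⟨1, fun _ => colElem (fun i => (o i : H)) hB, fun _ => rowElem (fun i => (o i : H)) hC,
    ?_, ?_⟩
  · rw [Fin.sum_univ_one]
    refine concreteMap_injective rankOneLift_injective ?_
    rw [concreteMap_effros, hcol, hrow]
    have hcc : hilbertMap (.id ℂ L) ((conjConj H).symm : ConjSpace (ConjSpace H) →L[ℂ] H) ∘L
        hilbertMap (.id ℂ L) (conjConj H : H →L[ℂ] ConjSpace (ConjSpace H)) = .id ℂ _ :=
      clm_ext_tmul fun ξ η => by simp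
    have hJJ := adjoint_insertVec_comp_insertVec (L := L) (e := (1 : ℂ)) (by simp)
    generalize hilbertMap (.id ℂ L) V.starProjection = Q at *
    ext x
    have e1 := fun x => congrArg (fun f => f x) hcc
    have e2 := fun x => congrArg (fun f => f x) hJJ
    have e3 := fun x => congrArg (fun f => f x) hBC
    have e4 := fun x => congrArg (fun f => f x) h₁
    have e5 := fun x => congrArg (fun f => f x) h₂
    simp only [ContinuousLinearMap.comp_apply, ContinuousLinearMap.id_apply] at e1 e2 e3 e4 e5 ⊢
    -- The two identifications cancel and `B C` becomes the operator of `U`, which absorbs the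
    -- projection `Q` on either side.
    rw [e1, e2, e3, e5, e4]
  · rw [Fin.sum_univ_one]
    have hu : colNorm L H (colElem (fun i => (o i : H)) hB) ≤ 1 := by
      unfold colNorm concreteNorm
      rw [hcol]
      refine (ContinuousLinearMap.opNorm_comp_le _ _).trans (mul_le_one₀ hQ (norm_nonneg _) ?_)
      refine (ContinuousLinearMap.opNorm_comp_le _ _).trans (mul_le_one₀ hB1 (norm_nonneg _) ?_)
      rwa [LinearIsometryEquiv.norm_map]
    have hv : rowNorm L (ConjSpace H) (rowElem (fun i => (o i : H)) hC) ≤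
        ‖concreteMap L (rankOneLift H) U‖ := by
      unfold rowNorm concreteNorm
      rw [hrow]
      refine (ContinuousLinearMap.opNorm_comp_le _ _).trans
        ((mul_le_of_le_one_left (norm_nonneg _) hJ).trans ?_)
      refine (ContinuousLinearMap.opNorm_comp_le _ _).trans
        ((mul_le_of_le_one_right (norm_nonneg _) ?_).trans hC1)
      exact (ContinuousLinearMap.opNorm_comp_le _ _).trans
        (mul_le_one₀ hQ (norm_nonneg _) (norm_hilbertMap_id_isometry_le _))
    exact (mul_le_of_le_one_left (concreteNorm_nonneg _ _) hu).trans hv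

theorem hasHaagerupDecomposition_norm_add (hL : ¬ FiniteDimensional ℂ L)
    (U : Amp L (H ⊗[ℂ] ConjSpace H)) {ε : ℝ} (hε : 0 < ε) :
    HasHaagerupDecomposition L U (‖concreteMap L (rankOneLift H) U‖ + ε) := by
  obtain ⟨V, hV, h⟩ := exists_hasHaagerupDecomposition_leftMul_one_sub U ε hε
  have hfin : V.starProjection ∈ finiteRank L := by
    refine Submodule.finiteDimensional_of_le (S₂ := V) ?_
    rintro _ ⟨x, rfl⟩
    exact V.starProjection_apply_mem x
  have h1 := hasHaagerupDecomposition_of_mem_finiteRank hL (concreteMap_mem_finiteRank hfin U)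
  rw [← leftMul_add_leftMul_one_sub V.starProjection U]
  refine (h1.mono ?_).add (h V le_rfl)
  -- The splitting of `U` was also substituted inside the norm; it is undone there.
  rw [leftMul_add_leftMul_one_sub, concreteMap_leftMul]
  exact (ContinuousLinearMap.opNorm_comp_le _ _).trans (mul_le_of_le_one_left (norm_nonneg _)
    ((norm_hilbertMap_id_le _).trans V.starProjection_norm_le))

theorem haagerupNorm_colNorm_rowNorm (hL : ¬ FiniteDimensional ℂ L) :
    haagerupNorm (colNorm L H) (rowNorm L (ConjSpace H)) = concreteNorm L (rankOneLift H) := by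
  funext U
  have hbound : ‖concreteMap L (rankOneLift H) U‖ ∈ lowerBounds {r : ℝ | ∃ (n : ℕ)
      (u : Fin n → Amp L H) (v : Fin n → Amp L (ConjSpace H)), U = ∑ k, effros (u k) (v k) ∧
        r = ∑ k, colNorm L H (u k) * rowNorm L (ConjSpace H) (v k)} := by
    rintro _ ⟨n, u, v, rfl, rfl⟩
    rw [map_sum]
    exact (norm_sum_le Finset.univ fun k => concreteMap L (rankOneLift H) (effros (u k) (v k))).trans
      (Finset.sum_le_sum fun k _ => norm_concreteMap_effros_le (u k) (v k))
  apply le_antisymm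
  · refine le_of_forall_pos_le_add fun ε hε => ?_
    obtain ⟨n, u, v, hU, hr⟩ := hasHaagerupDecomposition_norm_add hL U hε
    exact (csInf_le ⟨_, hbound⟩ ⟨n, u, v, hU, rfl⟩).trans hr
  -- Any positive `ε` would do: only nonemptiness of the set is needed, so that its infimum is not a
  -- default value.
  · obtain ⟨n, u, v, hU, -⟩ := hasHaagerupDecomposition_norm_add hL U one_pos
    exact le_csInf ⟨_, n, u, v, hU, rfl⟩ hbound

end Haagerup

end QFA

end

theorem proposition27
    {L : Type*} [NormedAddCommGroup L] [InnerProductSpace ℂ L] [CompleteSpace L]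
    [TopologicalSpace.SeparableSpace L] (hL : ¬ FiniteDimensional ℂ L)
    {H : Type*} [NormedAddCommGroup H] [InnerProductSpace ℂ H] [CompleteSpace H] :
    QFA.IsQuantumNorm
        (QFA.haagerupNorm (QFA.colNorm L H) (QFA.rowNorm L (QFA.ConjSpace H))) ∧
      QFA.IsQuantumNorm (QFA.standardNorm L (QFA.finiteRank H)) ∧
      ∃ φ : (H ⊗[ℂ] QFA.ConjSpace H) ≃ₗ[ℂ] QFA.finiteRank H,
        (∀ x y : H, (φ (x ⊗ₜ[ℂ] QFA.ConjSpace.conj H y) : H →L[ℂ] H) =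
          InnerProductSpace.rankOne ℂ x y) ∧
        QFA.IsCompletelyIsometric
          (QFA.haagerupNorm (QFA.colNorm L H) (QFA.rowNorm L (QFA.ConjSpace H)))
          (QFA.standardNorm L (QFA.finiteRank H)) φ := by
  rw [QFA.haagerupNorm_colNorm_rowNorm hL]
  refine ⟨QFA.isQuantumNorm_concreteNorm QFA.rankOneLift_injective,
    QFA.isQuantumNorm_concreteNorm (Submodule.subtype_injective _), QFA.rankOneEquiv H,
    fun x y => rfl, fun u => ?_⟩
  -- Both norms are now operator norms of the same operator on `L ⊗ H`.
  rw [QFA.standardNorm, QFA.concreteNorm, QFA.concreteMap_amplify, QFA.subtype_comp_rankOneEquiv,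
    QFA.concreteNorm]
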